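/- Let $\mathrm{GP}$ (the generalised polynomials) be the smallest set of functions $\mathbb{Z}\to\mathbb{R}$ that contains all maps $n\mapsto P(n)$ with $P\in\mathbb{R}[x]$ and is closed under (pointwise) addition, multiplication and the operation $f\mapsto\lfloor f\rfloor$ of taking the integer part. A set $E\subset\mathbb{Z}$ is called generalised polynomial if its characteristic function $\mathbf{1}_E\colon\mathbb{Z}\to\mathbb{R}$ belongs to $\mathrm{GP}$. For $r\in\mathbb{R}$ write $\langle\!\langle r\rangle\!\rangle=\lfloor r+1/2\rfloor$ for the nearest integer to $r$. **Theorem.** Let $p(x)=x^3-ax^2-bx-1$ with integers $a,b$ satisfying ($a\ge 0$ and $0\le b\le a+1$) or ($a\ge 2$ and $b=-1$). Assume that $p$ has a unique real root $\beta$ and that $\beta>1$. Then the set $\{\langle\!\langle \beta^n\rangle\!\rangle : n\ge 0\}$ is generalised polynomial. -/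

import Mathlib

/-- The family of generalised polynomials: the smallest set of functions `ℤ → ℝ` containing the
maps given by real polynomials and closed under addition, multiplication and taking the
(pointwise) integer part. -/
inductive IsGenPoly : (ℤ → ℝ) → Prop
  | poly (p : Polynomial ℝ) : IsGenPoly (fun n => p.eval (n : ℝ))
  | add {f g : ℤ → ℝ} : IsGenPoly f → IsGenPoly g → IsGenPoly (fun n => f n + g n)
  | mul {f g : ℤ → ℝ} : IsGenPoly f → IsGenPoly g → IsGenPoly (fun n => f n * g n)
  | floor {f : ℤ → ℝ} : IsGenPoly f → IsGenPoly (fun n => ((⌊f n⌋ : ℤ) : ℝ))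

/-- A set of integers is generalised polynomial if its characteristic function on all of `ℤ` is a
generalised polynomial. -/
def IsGenPolySet (E : Set ℤ) : Prop :=
  IsGenPoly (E.indicator (fun _ => (1 : ℝ)))

/-- The nearest integer `⌊r + 1/2⌋` to a real number `r`. -/
noncomputable def nearestInt (r : ℝ) : ℤ := ⌊r + 1 / 2⌋

/-! Let `θ` be the class of x in ℤ[x]/(p). It is a unit, and its non-real conjugates `α`, ᾱ satisfy
|α| < 1, so β^n is within 2|α|^n of the integer Tr(θ^n). For large n, the integer m = Tr(θ^n)
determines θ^n: its coordinates are the nearest integers to κ_i m, where κ is the coefficient vector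
of the real quadratic equal to 1 at β and 0 at α (`exists_nearestInt_coeff`). These roundings are
generalised polynomials in m, so every m yields a candidate x that can be tested.

The tests are: x has norm 1, trace m, and is congruent to a power of θ modulo a fixed q. By
`exists_modulus` they force x = θ^n with n ∈ ℤ: the powers of θ have finite index among the elements
of norm 1, and a suitable q separates the nontrivial cosets. Very negative n cannot occur, because
the complex embedding of a candidate is bounded (`norm_ψ_elem_le`). The tested set thus differs from
the wanted one by a finite set, which is harmless. -/

/-! ### Closure properties of generalised polynomials and generalised polynomial sets. -/

theorem nearestInt_eq {r : ℝ} {k : ℤ} (h : |k - r| < 1 / 2) : nearestInt r = k := by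
  rw [nearestInt, Int.floor_eq_iff]
  have := abs_lt.1 h
  constructor <;> linarith

theorem abs_nearestInt_sub_le (r : ℝ) : |(nearestInt r : ℝ) - r| ≤ 1 / 2 := by
  rw [nearestInt, abs_le]
  have h₁ := Int.floor_le (r + 1 / 2)
  have h₂ := Int.lt_floor_add_one (r + 1 / 2)
  constructor <;> linarith

theorem IsGenPoly.const (c : ℝ) : IsGenPoly (fun _ => c) := by
  simpa using IsGenPoly.poly (Polynomial.C c)

theorem IsGenPoly.intCast : IsGenPoly (fun n => (n : ℝ)) := by
  simpa using IsGenPoly.poly Polynomial.X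

theorem IsGenPoly.const_mul {f : ℤ → ℝ} (c : ℝ) (hf : IsGenPoly f) :
    IsGenPoly (fun n => c * f n) :=
  (IsGenPoly.const c).mul hf

theorem IsGenPoly.sub {f g : ℤ → ℝ} (hf : IsGenPoly f) (hg : IsGenPoly g) :
    IsGenPoly (fun n => f n - g n) := by
  simpa [sub_eq_add_neg] using hf.add (hg.const_mul (-1))

theorem IsGenPoly.nearestInt {f : ℤ → ℝ} (hf : IsGenPoly f) :
    IsGenPoly (fun n => (nearestInt (f n) : ℝ)) :=
  (hf.add (IsGenPoly.const (1 / 2))).floor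

theorem IsGenPolySet.inter {E F : Set ℤ} (hE : IsGenPolySet E) (hF : IsGenPolySet F) :
    IsGenPolySet (E ∩ F) := by
  unfold IsGenPolySet
  convert hE.mul hF using 2 with n
  by_cases h₁ : n ∈ E <;> by_cases h₂ : n ∈ F <;> simp [h₁, h₂]

theorem IsGenPolySet.compl {E : Set ℤ} (hE : IsGenPolySet E) : IsGenPolySet Eᶜ := by
  unfold IsGenPolySet
  convert (IsGenPoly.const 1).sub hE using 2 with n
  by_cases h₁ : n ∈ E <;> simp [h₁]

theorem IsGenPolySet.union {E F : Set ℤ} (hE : IsGenPolySet E) (hF : IsGenPolySet F) :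
    IsGenPolySet (E ∪ F) := by
  have := (hE.compl.inter hF.compl).compl
  rwa [Set.compl_inter, compl_compl, compl_compl] at this

theorem isGenPolySet_empty : IsGenPolySet ∅ := by
  unfold IsGenPolySet
  convert IsGenPoly.const 0 using 2 with n
  simp

theorem IsGenPolySet.biUnion {ι : Type*} {s : Set ι} (hs : s.Finite) {E : ι → Set ℤ}
    (hE : ∀ i ∈ s, IsGenPolySet (E i)) : IsGenPolySet (⋃ i ∈ s, E i) := by
  induction s, hs using Set.Finite.induction_on with
  | empty => simpa using isGenPolySet_empty
  | insert _ _ ih =>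
    rw [Set.biUnion_insert]
    exact (hE _ (Set.mem_insert _ _)).union (ih fun i hi => hE i (Set.mem_insert_of_mem _ hi))

/-- The floor of 1 - {f} is 1 when {f} = 0 and 0 otherwise. -/
theorem IsGenPoly.isGenPolySet_mem_int {f : ℤ → ℝ} (hf : IsGenPoly f) :
    IsGenPolySet {n | ∃ k : ℤ, f n = k} := by
  unfold IsGenPolySet
  convert ((IsGenPoly.const 1).sub (hf.sub hf.floor)).floor using 2 with n
  by_cases h : ∃ k : ℤ, f n = k
  · rw [Set.indicator_of_mem (by exact h)]
    obtain ⟨k, hk⟩ := h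
    simp [hk]
  · rw [Set.indicator_of_notMem (by exact h)]
    have h₀ : 0 < Int.fract (f n) := by
      refine lt_of_le_of_ne (Int.fract_nonneg _) fun h₀ => h ⟨⌊f n⌋, ?_⟩
      have := Int.floor_add_fract (f n)
      linarith
    have : ⌊1 - Int.fract (f n)⌋ = 0 := by
      rw [Int.floor_eq_iff]
      have := Int.fract_lt_one (f n)
      constructor <;> push_cast <;> linarith
    rw [Int.fract] at this
    rw [this]
    simp

/-- Since √2 is irrational, f and √2·f are both integers only where f vanishes. -/
theorem IsGenPoly.isGenPolySet_eq_zero {f : ℤ → ℝ} (hf : IsGenPoly f) :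
    IsGenPolySet {n | f n = 0} := by
  convert hf.isGenPolySet_mem_int.inter (hf.const_mul (√2)).isGenPolySet_mem_int using 1
  ext n
  constructor
  · intro h
    exact ⟨⟨0, by simpa using h⟩, ⟨0, by simp [show f n = 0 from h]⟩⟩
  · rintro ⟨⟨k, hk⟩, ⟨l, hl⟩⟩
    by_contra h₀
    change f n ≠ 0 at h₀
    rw [hk] at hl h₀
    exact ((irrational_sqrt_two.mul_intCast (by exact_mod_cast h₀)).ne_int l) hl

theorem IsGenPoly.isGenPolySet_eq {f g : ℤ → ℝ} (hf : IsGenPoly f) (hg : IsGenPoly g) :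
    IsGenPolySet {n | f n = g n} := by
  simpa [sub_eq_zero] using (hf.sub hg).isGenPolySet_eq_zero

theorem Set.Finite.isGenPolySet {E : Set ℤ} (hE : E.Finite) : IsGenPolySet E := by
  have h : IsGenPolySet (⋃ k ∈ E, {k}) := by
    refine IsGenPolySet.biUnion hE fun k _ => ?_
    convert IsGenPoly.intCast.isGenPolySet_eq (IsGenPoly.const (k : ℝ)) using 1
    ext n
    simp
  simpa using h

theorem IsGenPolySet.of_finite_diff {E S : Set ℤ} (hS : IsGenPolySet S) (h₁ : (E \ S).Finite)
    (h₂ : (S \ E).Finite) : IsGenPolySet E := by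
  have h := (hS.inter h₂.isGenPolySet.compl).union h₁.isGenPolySet
  convert h using 1
  ext n
  simp only [Set.mem_union, Set.mem_inter_iff, Set.mem_compl_iff, Set.mem_sdiff]
  tauto

theorem IsGenPoly.isGenPolySet_zmod_eq {c : ℤ → ℤ} (hc : IsGenPoly (fun n => (c n : ℝ)))
    {q : ℕ} [NeZero q] (r : ZMod q) : IsGenPolySet {n | (c n : ZMod q) = r} := by
  have hq : (q : ℝ) ≠ 0 := by exact_mod_cast NeZero.ne q
  convert ((hc.sub (IsGenPoly.const (r.val : ℝ))).const_mul (q : ℝ)⁻¹).isGenPolySet_mem_int using 1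
  ext n
  have h : (c n : ZMod q) = r ↔ (q : ℤ) ∣ c n - r.val := by
    rw [← ZMod.intCast_zmod_eq_zero_iff_dvd]
    simp [sub_eq_zero]
  simp only [Set.mem_ofPred_eq, h]
  refine exists_congr fun k => ?_
  rw [inv_mul_eq_div, div_eq_iff hq, mul_comm (k : ℝ)]
  exact_mod_cast Iff.rfl

theorem isGenPolySet_zmod {c₀ c₁ c₂ : ℤ → ℤ} (h₀ : IsGenPoly (fun n => (c₀ n : ℝ)))
    (h₁ : IsGenPoly (fun n => (c₁ n : ℝ))) (h₂ : IsGenPoly (fun n => (c₂ n : ℝ)))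
    {q : ℕ} [NeZero q] (P : ZMod q → ZMod q → ZMod q → Prop) :
    IsGenPolySet {n | P (c₀ n) (c₁ n) (c₂ n)} := by
  have h := IsGenPolySet.biUnion
    (Set.toFinite {r : ZMod q × ZMod q × ZMod q | P r.1 r.2.1 r.2.2})
    (fun r _ => (h₀.isGenPolySet_zmod_eq r.1).inter
      ((h₁.isGenPolySet_zmod_eq r.2.1).inter (h₂.isGenPolySet_zmod_eq r.2.2)))
  convert h using 1
  ext n
  simp only [Set.mem_ofPred_eq, Set.mem_iUnion, Set.mem_inter_iff, exists_prop]
  constructor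
  · intro h
    exact ⟨⟨c₀ n, c₁ n, c₂ n⟩, h, rfl, rfl, rfl⟩
  · rintro ⟨r, hr, e₀, e₁, e₂⟩
    rwa [e₀, e₁, e₂]

/-! ### Orders of a unit modulo prime powers. -/

/-- Choose s with u^d ≢ 1 mod l^s. The order of u mod l^s divides d·l^s but not d, so l divides that
order, which divides i. -/
theorem zpow_sub_one_dvd_imp_prime_dvd {R : Type*} [CommRing R] (u : Rˣ) {l d : ℕ} (hl : l.Prime)
    (hd : (l : R) ∣ (u : R) ^ d - 1) (hne : ∃ s : ℕ, ¬ (l : R) ^ s ∣ (u : R) ^ d - 1) :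
    ∃ s : ℕ, ∀ i : ℤ, (l : R) ^ s ∣ ((u ^ i : Rˣ) : R) - 1 → (l : ℤ) ∣ i := by
  obtain ⟨s, hs⟩ := hne
  refine ⟨s, fun i hi => ?_⟩
  by_contra hli
  let I := Ideal.span {(l : R) ^ s}
  let v := Units.map (Ideal.Quotient.mk I : R →* R ⧸ I) u
  have key : ∀ w : Rˣ, Units.map (Ideal.Quotient.mk I : R →* R ⧸ I) w = 1 ↔
      (l : R) ^ s ∣ (w : R) - 1 := by
    intro w
    rw [← Ideal.mem_span_singleton, ← Ideal.Quotient.eq, Units.ext_iff]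
    simp [I]
  have h₁ : v ^ i = 1 := by rw [← map_zpow, key]; exact hi
  have h₂ : v ^ (d * l ^ s) = 1 := by
    rw [← map_pow, key]
    have h := dvd_sub_pow_of_dvd_sub hd s
    rw [one_pow, ← pow_mul] at h
    push_cast
    exact (pow_dvd_pow _ (Nat.le_succ s)).trans h
  have h₃ : (orderOf v : ℤ) ∣ i := orderOf_dvd_iff_zpow_eq_one.2 h₁
  have h₄ : orderOf v ∣ d * l ^ s := orderOf_dvd_of_pow_eq_one h₂
  have h₅ : (orderOf v).Coprime (l ^ s) := by
    refine Nat.Coprime.pow_right s (((Nat.Prime.coprime_iff_not_dvd hl).2 fun h => hli ?_).symm)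
    exact (Int.natCast_dvd_natCast.2 h).trans h₃
  have h₆ : v ^ d = 1 := orderOf_dvd_iff_pow_eq_one.1 (h₅.dvd_of_dvd_mul_right h₄)
  rw [← map_pow, key] at h₆
  exact hs (by simpa using h₆)

/-! ### Real quadratics and their values at β and α. -/

/-- A real quadratic vanishing at α is a multiple of (x - α)(x - ᾱ), which is nonzero at β. -/
theorem cubic_combination_eq_zero {β : ℝ} {α : ℂ} (hα : α.im ≠ 0) {v₀ v₁ v₂ : ℝ}
    (h : v₀ + v₁ * β + v₂ * β ^ 2 = 0) (h' : (v₀ + v₁ * α + v₂ * α ^ 2 : ℂ) = 0) :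
    v₀ = 0 ∧ v₁ = 0 ∧ v₂ = 0 := by
  have hre := congrArg Complex.re h'
  have him := congrArg Complex.im h'
  simp [pow_two] at hre him
  have e₁ : v₁ = -2 * α.re * v₂ := by
    have : α.im * (v₁ + 2 * α.re * v₂) = 0 := by linear_combination him
    have := (mul_eq_zero.1 this).resolve_left hα
    linarith
  have e₂ : v₂ = 0 := by
    have : v₂ * ((β - α.re) ^ 2 + α.im ^ 2) = 0 := by
      rw [e₁] at h hre
      linear_combination h - hre
    exact (mul_eq_zero.1 this).resolve_right (by positivity)
  subst e₂
  simp at e₁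
  subst e₁
  simp at h
  exact ⟨h, rfl, rfl⟩

/-- The linear map sending the coefficients of a real polynomial of degree at most two to its values
at a real and at a complex number. -/
noncomputable def evalPair (β : ℝ) (α : ℂ) : (Fin 3 → ℝ) →ₗ[ℝ] ℝ × ℂ where
  toFun v := (v 0 + v 1 * β + v 2 * β ^ 2, v 0 + v 1 * α + v 2 * α ^ 2)
  map_add' v w := by
    ext1 <;> simp <;> ring
  map_smul' c v := by
    ext1 <;> simp <;> ring

theorem exists_coeff_bound {β : ℝ} {α : ℂ} (hα : α.im ≠ 0) :
    ∃ C : ℝ, 1 ≤ C ∧ ∀ v : Fin 3 → ℝ, ∀ i, |v i| ≤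
      C * (|v 0 + v 1 * β + v 2 * β ^ 2| + ‖(v 0 + v 1 * α + v 2 * α ^ 2 : ℂ)‖) := by
  have hker : LinearMap.ker (evalPair β α) = ⊥ := by
    rw [LinearMap.ker_eq_bot']
    intro v hv
    obtain ⟨h₀, h₁, h₂⟩ := cubic_combination_eq_zero hα (congrArg Prod.fst hv)
      (congrArg Prod.snd hv)
    ext i
    fin_cases i <;> assumption
  obtain ⟨K, -, hK⟩ := LinearMap.exists_antilipschitzWith _ hker
  refine ⟨max K 1, le_max_right _ _, fun v i => ?_⟩
  have h₁ := hK.le_mul_dist v 0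
  rw [map_zero, dist_zero_right, dist_zero_right] at h₁
  have h₂ : ‖evalPair β α v‖ ≤
      |v 0 + v 1 * β + v 2 * β ^ 2| + ‖(v 0 + v 1 * α + v 2 * α ^ 2 : ℂ)‖ := by
    rw [Prod.norm_def]
    exact max_le (le_add_of_nonneg_right (norm_nonneg _)) (le_add_of_nonneg_left (abs_nonneg _))
  calc |v i| ≤ ‖v‖ := norm_le_pi_norm v i
    _ ≤ K * ‖evalPair β α v‖ := h₁
    _ ≤ _ := by gcongr; exact le_max_left _ _

theorem exists_lagrange_coeff {β : ℝ} {α : ℂ} (hα : α.im ≠ 0) :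
    ∃ κ : Fin 3 → ℝ, κ 0 + κ 1 * β + κ 2 * β ^ 2 = 1 ∧
      (κ 0 + κ 1 * α + κ 2 * α ^ 2 : ℂ) = 0 := by
  have hD : (β - α.re) ^ 2 + α.im ^ 2 ≠ 0 := by positivity
  -- The coefficients of (x - α)(x - ᾱ) divided by its value at β.
  refine ⟨![(α.re ^ 2 + α.im ^ 2) / ((β - α.re) ^ 2 + α.im ^ 2),
    -2 * α.re / ((β - α.re) ^ 2 + α.im ^ 2), 1 / ((β - α.re) ^ 2 + α.im ^ 2)], ?_, ?_⟩
  · simp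
    field_simp
    ring
  · generalize (β - α.re) ^ 2 + α.im ^ 2 = D at hD
    apply Complex.ext <;> simp [pow_two, Complex.div_ofReal_re, Complex.div_ofReal_im] <;>
      field_simp <;> ring

/-! ### The order ℤ[θ] and its elements of norm one. -/

/-- A commutative ring `ℤ[θ]` generated by a cubic unit `θ`, with its real embedding, in which `θ` has
image `β > 1`, and one of its complex embeddings, in which `θ` has image `α`. -/
structure CubicOrder (R : Type*) [CommRing R] (β : ℝ) (α : ℂ) where
  /-- The real embedding. -/
  φ : R →+* ℝ
  /-- The complex embedding. -/
  ψ : R →+* ℂ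
  /-- The generator. -/
  θ : Rˣ
  /-- The trace of the generator. -/
  t₁ : ℤ
  /-- The trace of the square of the generator. -/
  t₂ : ℤ
  φ_θ : φ θ = β
  ψ_θ : ψ θ = α
  φ_injective : Function.Injective φ
  span : ∀ x : R, ∃ c : Fin 3 → ℤ, x = c 0 + c 1 * θ + c 2 * (θ : R) ^ 2
  one_lt : 1 < β
  norm_eq : β * ‖α‖ ^ 2 = 1
  im_ne : α.im ≠ 0
  trace_θ : β + 2 * α.re = t₁
  trace_θ_sq : β ^ 2 + 2 * (α ^ 2).re = t₂

namespace CubicOrder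

variable {R : Type*} [CommRing R] {β : ℝ} {α : ℂ} (D : CubicOrder R β α)

/-- The element with given coordinates. -/
def elem (c : Fin 3 → ℤ) : R := c 0 + c 1 * D.θ + c 2 * (D.θ : R) ^ 2

/-- The norm. -/
noncomputable def norm (x : R) : ℝ := D.φ x * ‖D.ψ x‖ ^ 2

/-- The trace, as a real number. -/
noncomputable def trace (x : R) : ℝ := D.φ x + 2 * (D.ψ x).re

theorem φ_elem (c : Fin 3 → ℤ) : D.φ (D.elem c) = c 0 + c 1 * β + c 2 * β ^ 2 := by
  simp [elem, D.φ_θ]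

theorem ψ_elem (c : Fin 3 → ℤ) : D.ψ (D.elem c) = c 0 + c 1 * α + c 2 * α ^ 2 := by
  simp [elem, D.ψ_θ]

theorem φ_zpow (n : ℤ) : D.φ ((D.θ ^ n : Rˣ) : R) = β ^ n := by
  have h := congrArg Units.val (map_zpow (Units.map (D.φ : R →* ℝ)) D.θ n)
  rw [Units.val_zpow_eq_zpow_val] at h
  simpa only [Units.coe_map, MonoidHom.coe_coe, D.φ_θ] using h

theorem ψ_zpow (n : ℤ) : D.ψ ((D.θ ^ n : Rˣ) : R) = α ^ n := by
  have h := congrArg Units.val (map_zpow (Units.map (D.ψ : R →* ℂ)) D.θ n)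
  rw [Units.val_zpow_eq_zpow_val] at h
  simpa only [Units.coe_map, MonoidHom.coe_coe, D.ψ_θ] using h

theorem norm_mul (x y : R) : D.norm (x * y) = D.norm x * D.norm y := by
  simp only [norm, map_mul, _root_.norm_mul]
  ring

theorem norm_zpow (n : ℤ) : D.norm ((D.θ ^ n : Rˣ) : R) = 1 := by
  rw [norm, φ_zpow, ψ_zpow, _root_.norm_zpow, ← zpow_natCast, ← zpow_mul, mul_comm n, zpow_mul,
    ← mul_zpow, zpow_natCast, D.norm_eq, one_zpow]

theorem exists_trace_elem (c : Fin 3 → ℤ) : D.trace (D.elem c) =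
    ((3 * c 0 + D.t₁ * c 1 + D.t₂ * c 2 : ℤ) : ℝ) := by
  rw [trace, φ_elem, ψ_elem]
  push_cast
  rw [← D.trace_θ, ← D.trace_θ_sq]
  simp
  ring

theorem elem_eq_zero {c : Fin 3 → ℤ} (h : D.elem c = 0) (i : Fin 3) : c i = 0 := by
  have h₁ := D.φ_elem c
  have h₂ := D.ψ_elem c
  rw [h, map_zero] at h₁ h₂
  obtain ⟨e₀, e₁, e₂⟩ := cubic_combination_eq_zero (v₀ := c 0) (v₁ := c 1) (v₂ := c 2) D.im_ne
    h₁.symm (by exact_mod_cast h₂.symm)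
  fin_cases i
  · exact_mod_cast e₀
  · exact_mod_cast e₁
  · exact_mod_cast e₂

theorem exists_pow_not_dvd (D : CubicOrder R β α) {l : ℕ} (hl : 1 < l) {z : R} (hz : z ≠ 0) :
    ∃ s : ℕ, ¬ (l : R) ^ s ∣ z := by
  by_contra! h
  obtain ⟨c, hc⟩ := D.span z
  refine hz ?_
  have h₀ : ∀ i, c i = 0 := by
    intro i
    by_contra hi
    obtain ⟨s, hs⟩ := pow_unbounded_of_one_lt (c i).natAbs hl
    obtain ⟨w, hw⟩ := h s
    obtain ⟨d, hd⟩ := D.span w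
    have : D.elem (fun j => c j - (l : ℤ) ^ s * d j) = 0 := by
      rw [hc, hd] at hw
      simp only [elem]
      push_cast
      linear_combination hw
    have hi' := D.elem_eq_zero this i
    have hdvd : (l : ℤ) ^ s ∣ c i := ⟨d i, by linarith⟩
    have h₃ := Int.natAbs_dvd_natAbs.2 hdvd
    have h₄ := Nat.le_of_dvd (Int.natAbs_pos.2 hi) h₃
    rw [Int.natAbs_pow, Int.natAbs_natCast] at h₄
    omega
  rw [hc]
  simp [h₀]

/-- Pigeonhole on the coordinates modulo q gives two congruent powers; the smaller one cancels
because θ is a unit. -/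
theorem exists_pow_sub_one_dvd {q : ℕ} (hq : 0 < q) : ∃ d : ℕ, 0 < d ∧
    (q : R) ∣ (D.θ : R) ^ d - 1 := by
  have : NeZero q := ⟨hq.ne'⟩
  choose c hc using fun n : ℕ => D.span ((D.θ : R) ^ n)
  obtain ⟨m, n, hmn, h⟩ := Finite.exists_ne_map_eq_of_infinite
    (fun n : ℕ => fun i => (c n i : ZMod q))
  wlog hlt : m < n generalizing m n
  · exact this n m hmn.symm h.symm (lt_of_le_of_ne (not_lt.1 hlt) hmn.symm)
  have hdvd : ∀ i, ∃ k : ℤ, c n i - c m i = q * k := by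
    intro i
    have := congrFun h i
    exact (ZMod.intCast_eq_intCast_iff_dvd_sub _ _ _).1 this
  choose k hk using hdvd
  refine ⟨n - m, Nat.sub_pos_of_lt hlt, ?_⟩
  have hz : (q : R) ∣ (D.θ : R) ^ n - (D.θ : R) ^ m := by
    refine ⟨D.elem k, ?_⟩
    have hk' : ∀ i, (c n i : R) - c m i = q * k i := fun i => by exact_mod_cast congrArg _ (hk i)
    rw [hc n, hc m, elem]
    linear_combination hk' 0 + hk' 1 * D.θ + hk' 2 * (D.θ : R) ^ 2
  have e : (D.θ : R) ^ n - (D.θ : R) ^ m = ((D.θ : R) ^ (n - m) - 1) * ((D.θ ^ m : Rˣ) : R) := by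
    rw [sub_mul, Units.val_pow_eq_pow_val, ← pow_add, Nat.sub_add_cancel hlt.le, one_mul]
  rw [e] at hz
  exact (Units.dvd_mul_right).1 hz

theorem exists_modulus_prime_dvd {l : ℕ} (hl : l.Prime) :
    ∃ s : ℕ, ∀ i : ℤ, (l : R) ^ s ∣ ((D.θ ^ i : Rˣ) : R) - 1 → (l : ℤ) ∣ i := by
  obtain ⟨d, hd, hdvd⟩ := D.exists_pow_sub_one_dvd hl.pos
  refine zpow_sub_one_dvd_imp_prime_dvd D.θ hl hdvd (D.exists_pow_not_dvd hl.one_lt fun h => ?_)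
  have h' := congrArg D.φ h
  simp only [map_sub, map_pow, D.φ_θ, map_one, map_zero] at h'
  have := one_lt_pow₀ D.one_lt hd.ne'
  linarith

/-- Norm 1 and φ x ≥ 1 force |ψ x| ≤ 1, so both embeddings, hence the integer coordinates, are
bounded. -/
theorem finite_fundamental_domain : {x : R | D.norm x = 1 ∧ 1 ≤ D.φ x ∧ D.φ x < β}.Finite := by
  obtain ⟨C, hC, hb⟩ := exists_coeff_bound (β := β) D.im_ne
  have hfin : (Set.Icc (fun _ : Fin 3 => -⌈C * (β + 1)⌉) (fun _ => ⌈C * (β + 1)⌉)).Finite :=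
    Set.finite_Icc _ _
  refine (hfin.image D.elem).subset ?_
  rintro x ⟨h₁, h₂, h₃⟩
  obtain ⟨c, hc⟩ := D.span x
  change x = D.elem c at hc
  have hψ : ‖D.ψ x‖ ≤ 1 := by
    by_contra! h
    have : 1 < D.φ x * ‖D.ψ x‖ ^ 2 := one_lt_mul h₂ (one_lt_pow₀ h two_ne_zero)
    exact this.ne' h₁
  have hc' : ∀ i, |(c i : ℝ)| ≤ C * (β + 1) := by
    intro i
    refine (hb (fun i => c i) i).trans ?_
    have hφ : |D.φ x| ≤ β := by rw [abs_of_nonneg (by linarith)]; exact h₃.le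
    rw [hc, φ_elem] at hφ
    rw [hc, ψ_elem] at hψ
    push_cast
    gcongr
  refine ⟨c, ⟨fun i => ?_, fun i => ?_⟩, hc.symm⟩
  · have h₄ := (abs_le.1 (hc' i)).1
    have h₅ := Int.le_ceil (C * (β + 1))
    have : (-⌈C * (β + 1)⌉ : ℝ) ≤ c i := by linarith
    exact_mod_cast this
  · have h₄ := (abs_le.1 (hc' i)).2
    have h₅ := Int.le_ceil (C * (β + 1))
    have : (c i : ℝ) ≤ ⌈C * (β + 1)⌉ := by linarith
    exact_mod_cast this

theorem exists_zpow_mul_mem {x : R} (hx : D.norm x = 1) : ∃ n : ℤ,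
    x * ((D.θ ^ (-n) : Rˣ) : R) ∈ {x : R | D.norm x = 1 ∧ 1 ≤ D.φ x ∧ D.φ x < β} := by
  have hpos : 0 < D.φ x := by
    by_contra! h
    have := mul_nonpos_of_nonpos_of_nonneg h (sq_nonneg ‖D.ψ x‖)
    rw [norm] at hx
    linarith
  have hβ : 0 < β := one_pos.trans D.one_lt
  obtain ⟨n, h₁, h₂⟩ := exists_mem_Ico_zpow hpos D.one_lt
  refine ⟨n, by rw [norm_mul, norm_zpow, hx, one_mul], ?_, ?_⟩
  · rwa [map_mul, φ_zpow, zpow_neg, ← div_eq_mul_inv, one_le_div (zpow_pos hβ n)]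
  · rwa [map_mul, φ_zpow, zpow_neg, ← div_eq_mul_inv, div_lt_iff₀ (zpow_pos hβ n), mul_comm,
      ← zpow_add_one₀ hβ.ne']

theorem exists_pow_eq_zpow {y : R} (hy : D.norm y = 1) : ∃ h : ℕ, 0 < h ∧ ∃ r : ℤ,
    D.φ y ^ h = β ^ r := by
  have hφ : D.φ y ≠ 0 := fun h => by simp [norm, h] at hy
  have hβ : β ≠ 0 := (one_pos.trans D.one_lt).ne'
  have hyn : ∀ n : ℕ, D.norm (y ^ n) = 1 := by
    intro n
    induction n with
    | zero => simp [norm]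
    | succ n ih => rw [pow_succ, norm_mul, ih, hy, one_mul]
  choose r hr using fun n : ℕ => D.exists_zpow_mul_mem (hyn n)
  have := D.finite_fundamental_domain.to_subtype
  obtain ⟨m, n, hmn, h⟩ := Finite.exists_ne_map_eq_of_infinite
    (fun n : ℕ => (⟨_, hr n⟩ : {x : R | D.norm x = 1 ∧ 1 ≤ D.φ x ∧ D.φ x < β}))
  wlog hlt : m < n generalizing m n
  · exact this n m hmn.symm h.symm (lt_of_le_of_ne (not_lt.1 hlt) hmn.symm)
  have h' := congrArg D.φ (Subtype.ext_iff.1 h)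
  simp only [map_mul, map_pow, φ_zpow] at h'
  simp only [zpow_neg] at h'
  refine ⟨n - m, Nat.sub_pos_of_lt hlt, r n - r m, ?_⟩
  rw [pow_sub₀ _ hφ hlt.le, zpow_sub₀ hβ]
  have := zpow_ne_zero (r m) hβ
  have := zpow_ne_zero (r n) hβ
  have := pow_ne_zero m hφ
  field_simp at h' ⊢
  linear_combination -h'

/-- A congruence that no power of θ satisfies excludes each nontrivial coset representative y. With
h minimal in y^h = θ^r, a prime l dividing h cannot divide r, whereas y ≡ θ^i modulo a suitable
power of l would make l divide r - ih. -/
theorem exists_modulus_of_mem {y : R}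
    (hy : y ∈ {x : R | D.norm x = 1 ∧ 1 ≤ D.φ x ∧ D.φ x < β}) :
    ∃ q : ℕ, 0 < q ∧ ∀ i : ℤ, (q : R) ∣ y - ((D.θ ^ i : Rˣ) : R) → y = 1 := by
  classical
  obtain ⟨hy, hy₁, hy₂⟩ := hy
  have hβ : 0 < β := one_pos.trans D.one_lt
  have hex := D.exists_pow_eq_zpow hy
  obtain ⟨hpos, r, hr⟩ := Nat.find_spec hex
  have hmin := fun k => Nat.find_min hex (m := k)
  generalize Nat.find hex = h at hpos hr hmin
  rcases Nat.eq_or_lt_of_le (Nat.succ_le_of_lt hpos) with h₁ | h₁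
  -- Here h = 1, so y = θ^r with 1 ≤ β^r < β and thus r = 0; any modulus will do.
  · refine ⟨1, one_pos, fun _ _ => D.φ_injective ?_⟩
    rw [← h₁, Nat.succ_eq_add_one, zero_add, pow_one] at hr
    rw [hr] at hy₁ hy₂ ⊢
    have h₂ : 0 ≤ r := (one_le_zpow_iff_right₀ D.one_lt).1 hy₁
    have h₃ : r < 1 := (zpow_lt_zpow_iff_right₀ D.one_lt).1 (by simpa using hy₂)
    rw [show r = 0 by omega, zpow_zero, map_one]
  · obtain ⟨l, hl, k, rfl⟩ := Nat.exists_prime_and_dvd (n := h) (by omega)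
    have hk : 0 < k := Nat.pos_of_mul_pos_left hpos
    have hlr : ¬ (l : ℤ) ∣ r := by
      rintro ⟨r', rfl⟩
      refine hmin k ((Nat.lt_mul_iff_one_lt_left hk).2 hl.one_lt) ⟨hk, r', ?_⟩
      -- Positive reals have unique l-th roots, so l dividing r would contradict the minimality of
      -- h.
      refine (pow_left_inj₀ (by positivity) (by positivity) hl.ne_zero).1 ?_
      rw [← pow_mul, mul_comm k l, hr, ← zpow_natCast (β ^ r'), ← zpow_mul, mul_comm]
    obtain ⟨s, hs⟩ := D.exists_modulus_prime_dvd hl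
    refine ⟨l ^ s, pow_pos hl.pos s, fun i hi => (hlr ?_).elim⟩
    have hyr : y ^ (l * k) = ((D.θ ^ r : Rˣ) : R) := D.φ_injective (by rw [map_pow, hr, φ_zpow])
    have h₂ := hi.trans (sub_dvd_pow_sub_pow y ((D.θ ^ i : Rˣ) : R) (l * k))
    have e : ((D.θ ^ i : Rˣ) : R) ^ (l * k) = ((D.θ ^ (i * (l * k)) : Rˣ) : R) := by
      rw [← Units.val_pow_eq_pow_val, zpow_mul]
      norm_cast
    rw [hyr, e] at h₂
    have e' : ((D.θ ^ r : Rˣ) : R) - ((D.θ ^ (i * (l * k)) : Rˣ) : R) =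
        (((D.θ ^ (r - i * (l * k)) : Rˣ) : R) - 1) * ((D.θ ^ (i * (l * k)) : Rˣ) : R) := by
      rw [sub_mul, ← Units.val_mul, ← zpow_add, sub_add_cancel, one_mul]
    rw [e', Units.dvd_mul_right] at h₂
    have h₃ := hs _ (by exact_mod_cast h₂)
    have h₄ : (l : ℤ) ∣ i * (l * k) := ⟨i * k, by ring⟩
    exact (dvd_sub_comm.1 h₃ |> fun h => by simpa using dvd_sub h₄ h)

/-- The product of the moduli over the finite fundamental domain serves all cosets at once. -/
theorem exists_modulus : ∃ q : ℕ, 0 < q ∧ ∀ x : R, D.norm x = 1 →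
    (∃ i : ℤ, (q : R) ∣ x - ((D.θ ^ i : Rˣ) : R)) → ∃ n : ℤ, x = ((D.θ ^ n : Rˣ) : R) := by
  have hF := D.finite_fundamental_domain
  choose! q hq h using fun y (hy : y ∈ {x : R | D.norm x = 1 ∧ 1 ≤ D.φ x ∧ D.φ x < β}) =>
    D.exists_modulus_of_mem hy
  refine ⟨∏ y ∈ hF.toFinset, q y, Finset.prod_pos fun y hy => hq y (hF.mem_toFinset.1 hy), ?_⟩
  rintro x hx ⟨i, hi⟩
  obtain ⟨n, hn⟩ := D.exists_zpow_mul_mem hx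
  refine ⟨n, ?_⟩
  have h₁ : (q (x * ((D.θ ^ (-n) : Rˣ) : R)) : R) ∣ x - ((D.θ ^ i : Rˣ) : R) :=
    dvd_trans (Nat.cast_dvd_cast (Finset.dvd_prod_of_mem q (hF.mem_toFinset.2 hn))) hi
  have h₂ := h _ hn (i - n) (by
    convert h₁.mul_right ((D.θ ^ (-n) : Rˣ) : R) using 1
    rw [sub_mul, ← Units.val_mul, ← zpow_add, sub_eq_add_neg i])
  calc x = x * ((D.θ ^ (-n) : Rˣ) : R) * ((D.θ ^ n : Rˣ) : R) := by
        rw [mul_assoc, ← Units.val_mul, ← zpow_add]; simp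
    _ = _ := by rw [h₂, one_mul]

end CubicOrder

/-! ### Recovering a power of θ from its trace. -/

namespace CubicOrder

variable {R : Type*} [CommRing R] {β : ℝ} {α : ℂ} (D : CubicOrder R β α)

theorem norm_α_lt_one (D : CubicOrder R β α) : ‖α‖ < 1 := by
  by_contra! h
  have := one_lt_mul_of_lt_of_le D.one_lt (one_le_pow₀ h (n := 2))
  exact this.ne' D.norm_eq

theorem isGenPoly_norm_elem {c : ℤ → Fin 3 → ℤ}
    (hc : ∀ i, IsGenPoly (fun m => (c m i : ℝ))) : IsGenPoly (fun m => D.norm (D.elem (c m))) := by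
  have hlin : ∀ x y : ℝ, IsGenPoly (fun m => (c m 0 : ℝ) + x * c m 1 + y * c m 2) := fun x y =>
    ((hc 0).add ((hc 1).const_mul x)).add ((hc 2).const_mul y)
  have hre := hlin α.re (α ^ 2).re
  have him := ((hc 1).const_mul α.im).add ((hc 2).const_mul (α ^ 2).im)
  convert (hlin β (β ^ 2)).mul ((hre.mul hre).add (him.mul him)) using 2 with m
  rw [norm, φ_elem, ψ_elem, ← Complex.normSq_eq_norm_sq, Complex.normSq_apply]
  simp
  ring

theorem isGenPoly_trace_elem {c : ℤ → Fin 3 → ℤ}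
    (hc : ∀ i, IsGenPoly (fun m => (c m i : ℝ))) : IsGenPoly (fun m => D.trace (D.elem (c m))) := by
  convert (((hc 0).const_mul 3).add ((hc 1).const_mul D.t₁)).add ((hc 2).const_mul D.t₂)
    using 2 with m
  rw [exists_trace_elem]
  push_cast
  ring

theorem isGenPolySet_elem_congr {c : ℤ → Fin 3 → ℤ}
    (hc : ∀ i, IsGenPoly (fun m => (c m i : ℝ))) {q : ℕ} [NeZero q] (P : R → Prop)
    (hP : ∀ x y, (q : R) ∣ x - y → P x → P y) :
    IsGenPolySet {m | P (D.elem (c m))} := by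
  have h := isGenPolySet_zmod (hc 0) (hc 1) (hc 2) (q := q)
    (fun r₀ r₁ r₂ => P (D.elem ![r₀.val, r₁.val, r₂.val]))
  convert h using 1
  ext m
  have hdvd : ∀ i, ∃ k : ℤ, c m i - ((c m i : ZMod q).val : ℤ) = q * k := fun i =>
    (ZMod.intCast_eq_intCast_iff_dvd_sub _ _ _).1 (by simp)
  choose k hk using hdvd
  have hk' : ∀ i, (c m i : R) - ((c m i : ZMod q).val : ℤ) = q * k i := fun i => by
    exact_mod_cast congrArg (Int.cast : ℤ → R) (hk i)
  have e : D.elem (c m) - D.elem ![(c m 0 : ZMod q).val, (c m 1 : ZMod q).val,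
      (c m 2 : ZMod q).val] = q * D.elem k := by
    simp only [elem, Matrix.cons_val_zero, Matrix.cons_val_one, Matrix.cons_val]
    linear_combination hk' 0 + hk' 1 * D.θ + hk' 2 * (D.θ : R) ^ 2
  exact ⟨hP _ _ ⟨_, e⟩, hP _ _ (dvd_sub_comm.1 ⟨_, e⟩)⟩

theorem abs_trace_sub_le (x : R) : |D.trace x - D.φ x| ≤ 2 * ‖D.ψ x‖ := by
  rw [trace, add_sub_cancel_left, abs_mul, abs_two]
  gcongr
  exact Complex.abs_re_le_norm _

theorem exists_nearestInt_coeff {κ : Fin 3 → ℝ} (h₁ : κ 0 + κ 1 * β + κ 2 * β ^ 2 = 1)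
    (h₂ : (κ 0 + κ 1 * α + κ 2 * α ^ 2 : ℂ) = 0) : ∃ ε : ℝ, 0 < ε ∧ ε ≤ 1 / 6 ∧
      ∀ c : Fin 3 → ℤ, ‖D.ψ (D.elem c)‖ < ε →
        ∀ i, nearestInt (κ i * D.trace (D.elem c)) = c i := by
  obtain ⟨C, hC, hb⟩ := exists_coeff_bound (β := β) D.im_ne
  -- The coordinate error is at most C·(2 + 1)·|ψ|, which must stay below 1/2.
  refine ⟨1 / (6 * C), by positivity, ?_, fun c hc i => nearestInt_eq ?_⟩
  · exact one_div_le_one_div_of_le (by norm_num) (by linarith)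
  · set m := D.trace (D.elem c)
    refine (hb (fun i => c i - κ i * m) i).trans_lt ?_
    have e₁ : (c 0 - κ 0 * m) + (c 1 - κ 1 * m) * β + (c 2 - κ 2 * m) * β ^ 2 =
        D.φ (D.elem c) - m := by
      rw [φ_elem]
      linear_combination -m * h₁
    have e₂ : (((c 0 - κ 0 * m : ℝ) : ℂ) + ((c 1 - κ 1 * m : ℝ) : ℂ) * α +
        ((c 2 - κ 2 * m : ℝ) : ℂ) * α ^ 2) = D.ψ (D.elem c) := by
      rw [ψ_elem]
      push_cast
      linear_combination -(m : ℂ) * h₂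
    rw [e₁, e₂, abs_sub_comm]
    have h₃ := D.abs_trace_sub_le (D.elem c)
    rw [lt_div_iff₀ (by positivity)] at hc
    calc C * (|m - D.φ (D.elem c)| + ‖D.ψ (D.elem c)‖)
        ≤ C * (2 * ‖D.ψ (D.elem c)‖ + ‖D.ψ (D.elem c)‖) := by gcongr
      _ < 1 / 2 := by linarith

/-- As κ vanishes at α, only the three rounding errors contribute, each at most 1/2. -/
theorem norm_ψ_elem_le (D : CubicOrder R β α) {κ : Fin 3 → ℝ}
    (h : (κ 0 + κ 1 * α + κ 2 * α ^ 2 : ℂ) = 0) (m : ℝ) :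
    ‖D.ψ (D.elem (fun i => nearestInt (κ i * m)))‖ ≤ 3 / 2 := by
  have hα := D.norm_α_lt_one.le
  have hn : ∀ i, ‖((nearestInt (κ i * m) - κ i * m : ℝ) : ℂ)‖ ≤ 1 / 2 := fun i => by
    rw [Complex.norm_real]
    exact abs_nearestInt_sub_le _
  have e : D.ψ (D.elem (fun i => nearestInt (κ i * m))) =
      ((nearestInt (κ 0 * m) - κ 0 * m : ℝ) : ℂ) +
      ((nearestInt (κ 1 * m) - κ 1 * m : ℝ) : ℂ) * α +
      ((nearestInt (κ 2 * m) - κ 2 * m : ℝ) : ℂ) * α ^ 2 := by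
    rw [ψ_elem]
    push_cast
    linear_combination (m : ℂ) * h
  rw [e]
  refine (norm_add₃_le).trans ?_
  rw [_root_.norm_mul, _root_.norm_mul, norm_pow]
  have h₁ := mul_le_mul (hn 1) hα (norm_nonneg _) (by norm_num)
  have h₂ := mul_le_mul (hn 2) (pow_le_one₀ (n := 2) (norm_nonneg _) hα) (by positivity)
    (by norm_num)
  linarith [hn 0]

theorem isGenPolySet_nearestInt_pow (D : CubicOrder R β α) :
    IsGenPolySet {m : ℤ | ∃ n : ℕ, m = nearestInt (β ^ n)} := by
  obtain ⟨κ, hκ₁, hκ₂⟩ := exists_lagrange_coeff (β := β) D.im_ne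
  obtain ⟨ε, hε₀, hε, hcoeff⟩ := D.exists_nearestInt_coeff hκ₁ hκ₂
  obtain ⟨q, hq, hmod⟩ := D.exists_modulus
  have : NeZero q := ⟨hq.ne'⟩
  let c : ℤ → Fin 3 → ℤ := fun m i => nearestInt (κ i * m)
  have hc : ∀ i, IsGenPoly (fun m => (c m i : ℝ)) := fun i =>
    (IsGenPoly.intCast.const_mul (κ i)).nearestInt
  have hS := ((D.isGenPoly_norm_elem hc).isGenPolySet_eq (IsGenPoly.const 1)).inter
    (((D.isGenPoly_trace_elem hc).isGenPolySet_eq IsGenPoly.intCast).inter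
    (D.isGenPolySet_elem_congr hc (q := q) (fun x => ∃ i : ℤ, (q : R) ∣ x - ((D.θ ^ i : Rˣ) : R))
      fun x y hxy ⟨i, hi⟩ => ⟨i, by
        have := dvd_sub hi hxy
        rwa [sub_sub_sub_cancel_left] at this⟩))
  obtain ⟨N, hN⟩ : ∃ N : ℕ, ∀ n ≥ N, ‖α‖ ^ n < ε := by
    have := tendsto_pow_atTop_nhds_zero_of_lt_one (norm_nonneg α) D.norm_α_lt_one
    exact Filter.eventually_atTop.1 (this.eventually_lt_const hε₀)
  have hround : ∀ (n : ℕ), N ≤ n → ∀ m : ℤ, D.trace ((D.θ ^ (n : ℤ) : Rˣ) : R) = m →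
      nearestInt (β ^ n) = m := by
    intro n hn m hm
    refine nearestInt_eq ?_
    have h := D.abs_trace_sub_le ((D.θ ^ (n : ℤ) : Rˣ) : R)
    rw [hm, φ_zpow, ψ_zpow, zpow_natCast, zpow_natCast, norm_pow] at h
    have := hN n hn
    linarith
  refine hS.of_finite_diff ?_ ?_
  · refine ((Set.finite_lt_nat N).image (fun n => nearestInt (β ^ n))).subset ?_
    rintro m ⟨⟨n, rfl⟩, hm⟩
    refine ⟨n, ?_, rfl⟩
    by_contra hn
    have hn : N ≤ n := not_lt.1 hn
    refine hm ?_
    obtain ⟨d, hd⟩ := D.span ((D.θ ^ (n : ℤ) : Rˣ) : R)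
    change _ = D.elem d at hd
    have htr := D.exists_trace_elem d
    have hm := hround n hn _ (by rw [hd]; exact htr)
    rw [hm]
    have hcd : c (3 * d 0 + D.t₁ * d 1 + D.t₂ * d 2) = d := by
      funext i
      have h := hcoeff d (by rw [← hd, ψ_zpow, zpow_natCast, norm_pow]; exact hN n hn) i
      rwa [htr] at h
    refine ⟨?_, ?_, ?_⟩
    · change D.norm (D.elem (c _)) = 1
      rw [hcd, ← hd, norm_zpow]
    · change D.trace (D.elem (c _)) = _
      rw [hcd, htr]
    · change ∃ i : ℤ, (q : R) ∣ D.elem (c _) - ((D.θ ^ i : Rˣ) : R)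
      rw [hcd, ← hd]
      exact ⟨n, by simp⟩
  -- Any m that passes the tests wrongly is Tr(θ^n) with |n| < N.
  · refine ((Set.finite_Ioo (-(N : ℤ)) N).image
      (fun n => ⌊D.trace ((D.θ ^ n : Rˣ) : R)⌋)).subset ?_
    rintro m ⟨⟨h₁, h₂, h₃⟩, hm⟩
    change D.norm (D.elem (c m)) = 1 at h₁
    change D.trace (D.elem (c m)) = m at h₂
    obtain ⟨n, hn⟩ := hmod _ h₁ h₃
    rw [hn] at h₂
    refine ⟨n, ⟨?_, ?_⟩, by simp [h₂]⟩
    · by_contra! hlt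
      obtain ⟨k, hk⟩ := Int.eq_ofNat_of_zero_le (show 0 ≤ -n by omega)
      obtain rfl : n = -k := by omega
      have h₄ := D.norm_ψ_elem_le hκ₂ m
      change ‖D.ψ (D.elem (c m))‖ ≤ 3 / 2 at h₄
      have hα : α ≠ 0 := fun h => D.im_ne (by simp [h])
      -- For n = -k with k ≥ N this gives |α|^k ≥ 2/3, against |α|^k < ε ≤ 1/6.
      rw [hn, ψ_zpow, _root_.norm_zpow, zpow_neg, zpow_natCast,
        inv_le_comm₀ (by positivity) (by norm_num)] at h₄
      have := hN k (by omega)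
      linarith
    · by_contra! hle
      obtain ⟨k, rfl⟩ := Int.eq_ofNat_of_zero_le (show 0 ≤ n by omega)
      exact hm ⟨k, (hround k (by omega) m h₂).symm⟩

end CubicOrder

/-! ### Constructing the order from the cubic polynomial. -/

open Polynomial in
theorem exists_cubicOrder {a b : ℤ} {β : ℝ}
    (hroot : β ^ 3 - (a : ℝ) * β ^ 2 - (b : ℝ) * β - 1 = 0)
    (huniq : ∀ x : ℝ, x ^ 3 - (a : ℝ) * x ^ 2 - (b : ℝ) * x - 1 = 0 → x = β) (hβ : 1 < β) :
    ∃ (p : ℤ[X]) (α : ℂ), Nonempty (CubicOrder (AdjoinRoot p) β α) := by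
  have hβ₀ : 0 < β := one_pos.trans hβ
  -- The cofactor x² + (β - a)x + 1/β has negative discriminant: real roots would both equal β by
  -- uniqueness, making β a triple root with β³ = 1.
  have hdisc : (β - a) ^ 2 < 4 / β := by
    by_contra! h
    set s := √((β - a) ^ 2 - 4 / β) with hs
    have hs₂ : s ^ 2 = (β - a) ^ 2 - 4 / β := Real.sq_sqrt (by linarith)
    have hfac : ∀ x : ℝ, x ^ 2 + (β - a) * x + 1 / β = 0 →
        x ^ 3 - (a : ℝ) * x ^ 2 - (b : ℝ) * x - 1 = 0 := by
      intro x hx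
      have hb : (b : ℝ) = β ^ 2 - a * β - 1 / β := by field_simp; linarith
      rw [hb]
      have : β * (1 / β) = 1 := by field_simp
      linear_combination (x - β) * hx + this
    have r₁ := huniq _ (hfac ((a - β + s) / 2) (by linear_combination hs₂ / 4))
    have r₂ := huniq _ (hfac ((a - β - s) / 2) (by linear_combination hs₂ / 4))
    have hs₀ : s = 0 := by linarith
    have h₃ : β ^ 3 = 1 := by
      rw [hs₀] at hs₂
      have : (β - a) = -2 * β := by linarith
      rw [this] at hs₂
      field_simp at hs₂
      linarith
    linarith [one_lt_pow₀ hβ three_ne_zero]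
  set t := √(1 / β - (β - a) ^ 2 / 4) with ht
  have ht₀ : 0 < t := Real.sqrt_pos.2 (by
    have : 4 / β = 4 * (1 / β) := by ring
    linarith)
  have ht₂ : t ^ 2 = 1 / β - (β - a) ^ 2 / 4 := Real.sq_sqrt (Real.sqrt_pos.1 ht₀).le
  have hinv : β * (1 / β) = 1 := by field_simp
  have hb : (b : ℝ) = β ^ 2 - a * β - 1 / β := by field_simp; linarith
  set α : ℂ := ⟨(a - β) / 2, t⟩ with hα
  have hαroot : α ^ 3 - a * α ^ 2 - b * α - 1 = 0 := by
    have hq : α ^ 2 + (β - a) * α + (1 / β : ℝ) = 0 := by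
      apply Complex.ext
      · simp [pow_two, hα]
        have : t * t = _ := (pow_two t).symm.trans ht₂
        rw [one_div] at this
        linear_combination -this
      · simp [pow_two, hα]
        ring
    have hb' : (b : ℂ) = β ^ 2 - a * β - (1 / β : ℝ) := by exact_mod_cast congrArg Complex.ofReal hb
    have hinv' : (β : ℂ) * (1 / β : ℝ) = 1 := by exact_mod_cast congrArg Complex.ofReal hinv
    rw [hb']
    linear_combination (α - β) * hq + hinv'
  let p : ℤ[X] := X ^ 3 - C a * X ^ 2 - C b * X - 1
  have hdeg : p.natDegree = 3 := by simp only [p]; compute_degree!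
  have hmonic : p.Monic := by simp only [p]; monicity!
  have hp₀ : p ≠ 0 := hmonic.ne_zero
  have hirr : Irreducible p := by
    rw [hmonic.irreducible_iff_roots_eq_zero_of_degree_le_three (by omega) hdeg.le,
      Multiset.eq_zero_iff_forall_notMem]
    intro k hk
    have hk : k ^ 3 - a * k ^ 2 - b * k - 1 = 0 := by
      simpa [p, IsRoot] using (mem_roots hp₀).1 hk
    have hkβ : (k : ℝ) = β := huniq _ (by exact_mod_cast hk)
    have hk₁ : 1 < k := by rw [← hkβ] at hβ; exact_mod_cast hβ
    -- An integer root would divide the constant term, yet equal β > 1.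
    have hdvd : k ∣ 1 := ⟨k ^ 2 - a * k - b, by linear_combination -hk⟩
    have := Int.le_of_dvd one_pos hdvd
    omega
  have heval : ∀ {S : Type} [CommRing S] (i : ℤ →+* S) (x : S),
      p.eval₂ i x = x ^ 3 - a * x ^ 2 - b * x - 1 := fun i x => by
    simp only [p, eval₂_sub, eval₂_mul, eval₂_pow, eval₂_X, eval₂_C, eval₂_one]
    simp only [eq_intCast]
  have hφ : p.eval₂ (Int.castRingHom ℝ) β = 0 := by rw [heval]; exact hroot
  have hψ : p.eval₂ (Int.castRingHom ℂ) α = 0 := by rw [heval]; exact hαroot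
  have hint : IsIntegral ℤ β := ⟨p, hmonic, hφ⟩
  -- This makes φ injective: a polynomial vanishing at β is a multiple of p.
  have hmin : p ∣ minpoly ℤ β := by
    have h₁ : minpoly ℤ β ∣ p := minpoly.isIntegrallyClosed_dvd hint hφ
    exact (hirr.dvd_iff.1 h₁).elim (fun h => ((minpoly.not_isUnit ℤ β) h).elim)
      fun h => h.dvd
  have hθ : AdjoinRoot.root p ^ 3 - (a : AdjoinRoot p) * AdjoinRoot.root p ^ 2 -
      (b : AdjoinRoot p) * AdjoinRoot.root p - 1 = 0 := by
    have h : p.eval₂ (AdjoinRoot.of p) (AdjoinRoot.root p) = 0 := AdjoinRoot.eval₂_root p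
    rwa [heval] at h
  have hθinv : AdjoinRoot.root p * (AdjoinRoot.root p ^ 2 - a * AdjoinRoot.root p - b) = 1 := by
    linear_combination hθ
  refine ⟨p, α, ⟨{
    φ := AdjoinRoot.lift _ β hφ
    ψ := AdjoinRoot.lift _ α hψ
    θ := ⟨AdjoinRoot.root p, _, hθinv, by rw [mul_comm]; exact hθinv⟩
    t₁ := a
    t₂ := a ^ 2 + 2 * b
    φ_θ := AdjoinRoot.lift_root hφ
    ψ_θ := AdjoinRoot.lift_root hψ
    φ_injective := ?_
    span := ?_
    one_lt := hβ
    norm_eq := ?_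
    im_ne := ht₀.ne'
    trace_θ := ?_
    trace_θ_sq := ?_ }⟩⟩
  · rw [injective_iff_map_eq_zero]
    intro x hx
    induction x using AdjoinRoot.induction_on with
    | ih f =>
      rw [AdjoinRoot.lift_mk] at hx
      exact AdjoinRoot.mk_eq_zero.2 (hmin.trans (minpoly.isIntegrallyClosed_dvd hint hx))
  · intro x
    obtain ⟨f, rfl⟩ := AdjoinRoot.mk_surjective x
    have hlt : (f %ₘ p).natDegree < 3 := by
      rw [← hdeg]
      exact natDegree_modByMonic_lt f hmonic fun h => by simp [h] at hdeg
    refine ⟨fun i => (f %ₘ p).coeff i, ?_⟩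
    have h₁ : AdjoinRoot.mk p f = AdjoinRoot.mk p (f %ₘ p) := by
      have h := AdjoinRoot.mk_leftInverse hmonic (AdjoinRoot.mk p f)
      rw [AdjoinRoot.modByMonicHom_mk] at h
      exact h.symm
    rw [h₁]
    conv_lhs => rw [as_sum_range' _ 3 hlt]
    simp [Finset.sum_range_succ, ← C_mul_X_pow_eq_monomial]
  · rw [← Complex.normSq_eq_norm_sq, Complex.normSq_apply]
    simp only [hα]
    linear_combination β * ht₂ + hinv
  · simp only [hα]
    ring
  · simp [hα, pow_two]
    rw [hb]
    linear_combination -2 * ht₂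

theorem mainTheorem10 (a b : ℤ)
    (hab : (0 ≤ a ∧ 0 ≤ b ∧ b ≤ a + 1) ∨ (2 ≤ a ∧ b = -1))
    (β : ℝ)
    (hroot : β ^ 3 - (a : ℝ) * β ^ 2 - (b : ℝ) * β - 1 = 0)
    (huniq : ∀ x : ℝ, x ^ 3 - (a : ℝ) * x ^ 2 - (b : ℝ) * x - 1 = 0 → x = β)
    (hβ : 1 < β) :
    IsGenPolySet {m : ℤ | ∃ n : ℕ, m = nearestInt (β ^ n)} := by
  obtain ⟨p, α, ⟨D⟩⟩ := exists_cubicOrder hroot huniq hβ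
  exact D.isGenPolySet_nearestInt_pow
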